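/- Let $K$ be a field of characteristic $0$; all algebras are unital associative $K$-algebras. For an algebra $R$ let $T(R)$ be the ideal of polynomial identities of $R$ in the free algebra $K\langle x_1,x_2,\ldots\rangle$, i.e. the set of all $f$ which vanish under every substitution of the variables by elements of $R$, and for $d\ge 0$ let $$F_d(R)=K\langle x_1,\ldots,x_d\rangle/\bigl(K\langle x_1,\ldots,x_d\rangle\cap T(R)\bigr)$$ be the relatively free algebra of rank $d$ in the variety generated by $R$. For $n=(n_1,\ldots,n_d)$ with integers $n_i\ge 0$ let $F_d^{(n)}(R)$ be its homogeneous component of degree $n$, i.e. the (finite-dimensional) image in $F_d(R)$ of the linear span of all words in $x_1,\ldots,x_d$ in which each $x_i$ occurs exactly $n_i$ times, and let $$H(F_d(R);t_1,\ldots,t_d)=\sum_{n_1,\ldots,n_d\ge 0}\dim_K F_d^{(n_1,\ldots,n_d)}(R)\,t_1^{n_1}\cdots t_d^{n_d}$$ be its multigraded Hilbert series, a formal power series. **Theorem.** Let $U_k=U_k(K)$ be the algebra of upper triangular $k\times k$ matrices over $K$. For all integers $k,d\ge 0$, $$H(F_d(U_k);t_1,\ldots,t_d)=\frac{1}{t_1+\cdots+t_d-1}\left(\left(1+(t_1+\cdots+t_d-1)\prod_{i=1}^d\frac{1}{1-t_i}\right)^k-1\right)$$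 $$=\sum_{j=1}^k\binom{k}{j}\left(\prod_{i=1}^d\frac{1}{1-t_i}\right)^j(t_1+\cdots+t_d-1)^{j-1},$$ as identities in the ring of formal power series $\mathbb{Q}[[t_1,\ldots,t_d]]$, in which $1-t_i$ and $t_1+\cdots+t_d-1$ are invertible. (For $k=0$, $U_0$ is the zero algebra and all terms are $0$.) -/

import Mathlib

/-- The ideal `T(R)` of the polynomial identities of the unital `K`-algebra `R` in the free unital
associative algebra `K⟨x₀, x₁, x₂, …⟩` of countable rank: the polynomials `f` which vanish under
every substitution of the variables by elements of `R`. -/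
noncomputable def polynomialIdentities (K : Type*) [Field K] (R : Type*) [Ring R] [Algebra K R] :
    Ideal (FreeAlgebra K ℕ) :=
  ⨅ a : ℕ → R, RingHom.ker (FreeAlgebra.lift K a)

instance (K : Type*) [Field K] (R : Type*) [Ring R] [Algebra K R] :
    (polynomialIdentities K R).IsTwoSided := by
  unfold polynomialIdentities
  infer_instance

/-- The inclusion `K⟨x₀, …, x_{d-1}⟩ → K⟨x₀, x₁, x₂, …⟩`. -/
noncomputable def freeAlgebraIncl (K : Type*) [Field K] (d : ℕ) :
    FreeAlgebra K (Fin d) →ₐ[K] FreeAlgebra K ℕ :=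
  FreeAlgebra.lift K fun i : Fin d => FreeAlgebra.ι K (i : ℕ)

/-- The identities of `R` in the first `d` variables: `K⟨X_d⟩ ∩ T(R)`, as an ideal of `K⟨X_d⟩`. -/
noncomputable def identitiesInVars (K : Type*) [Field K] (R : Type*) [Ring R] [Algebra K R]
    (d : ℕ) : Ideal (FreeAlgebra K (Fin d)) :=
  (polynomialIdentities K R).comap (freeAlgebraIncl K d)

instance (K : Type*) [Field K] (R : Type*) [Ring R] [Algebra K R] (d : ℕ) :
    (identitiesInVars K R d).IsTwoSided := by
  unfold identitiesInVars
  infer_instance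

/-- The relatively free algebra `F_d(R) = K⟨X_d⟩ / (K⟨X_d⟩ ∩ T(R))` of rank `d` in the variety
generated by `R`. -/
abbrev RelativelyFreeAlgebra (K : Type*) [Field K] (R : Type*) [Ring R] [Algebra K R] (d : ℕ) :
    Type _ :=
  FreeAlgebra K (Fin d) ⧸ identitiesInVars K R d

/-- The multihomogeneous component of degree `(n₁, …, n_d)` of `K⟨X_d⟩`: the linear span of the
words in which each variable `x_i` occurs exactly `n_i` times. -/
noncomputable def freeComponent (K : Type*) [Field K] (d : ℕ) (n : Fin d →₀ ℕ) :
    Submodule K (FreeAlgebra K (Fin d)) :=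
  Submodule.span K
    {w | ∃ l : List (Fin d), (∀ i, l.count i = n i) ∧ (l.map (FreeAlgebra.ι K)).prod = w}

/-- The multihomogeneous component `F_d^{(n₁, …, n_d)}(R)` of the relatively free algebra. -/
noncomputable def relativelyFreeComponent (K : Type*) [Field K] (R : Type*) [Ring R] [Algebra K R]
    (d : ℕ) (n : Fin d →₀ ℕ) : Submodule K (RelativelyFreeAlgebra K R d) :=
  (freeComponent K d n).map (Ideal.Quotient.mkₐ K (identitiesInVars K R d)).toLinearMap

/-- The multigraded Hilbert series `H(F_d(R), t₁, …, t_d)`. -/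
noncomputable def hilbertSeries (K : Type*) [Field K] (R : Type*) [Ring R] [Algebra K R] (d : ℕ) :
    MvPowerSeries (Fin d) ℚ :=
  fun n => (Module.finrank K (relativelyFreeComponent K R d n) : ℚ)

/-- The algebra `U_k(K)` of the upper triangular `k × k` matrices. -/
abbrev upperTriangularAlgebra (K : Type*) [Field K] (k : ℕ) :
    Subalgebra K (Matrix (Fin k) (Fin k) K) :=
  Matrix.blockTriangularSubalgebra K K (id : Fin k → Fin k)

/-! The Hilbert series is well defined: the components are finite dimensional, and in characteristic
zero the algebra `F_d(R)` is their direct sum. -/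

instance (K : Type*) [Field K] (d : ℕ) (n : Fin d →₀ ℕ) : Module.Finite K (freeComponent K d n) := by
  have hf : {l : List (Fin d) | ∀ i, l.count i = n i}.Finite := by
    refine (List.finite_length_eq (Fin d) (∑ i, n i)).subset fun l hl => ?_
    have h := Multiset.sum_count_eq_card (s := Finset.univ) (m := (l : Multiset (Fin d)))
      (fun a _ => Finset.mem_univ a)
    simp only [Multiset.coe_count, Multiset.coe_card] at h
    change l.length = _
    rw [← h]
    exact Finset.sum_congr rfl fun i _ => hl i
  exact Module.Finite.span_of_finite K
    (hf.image fun l : List (Fin d) => (l.map (FreeAlgebra.ι K)).prod)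

instance (K : Type*) [Field K] (R : Type*) [Ring R] [Algebra K R] (d : ℕ) (n : Fin d →₀ ℕ) :
    Module.Finite K (relativelyFreeComponent K R d n) := by
  unfold relativelyFreeComponent
  infer_instance

theorem mem_identitiesInVars_iff {K : Type*} [Field K] {R : Type*} [Ring R] [Algebra K R] {d : ℕ}
    {f : FreeAlgebra K (Fin d)} :
    f ∈ identitiesInVars K R d ↔ ∀ a : Fin d → R, FreeAlgebra.lift K a f = 0 := by
  have key : ∀ a : ℕ → R, FreeAlgebra.lift K a (freeAlgebraIncl K d f) =
      FreeAlgebra.lift K (fun i : Fin d => a i) f := by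
    intro a
    have : (FreeAlgebra.lift K a).comp (freeAlgebraIncl K d) =
        FreeAlgebra.lift K (fun i : Fin d => a i) := by
      ext i
      simp [freeAlgebraIncl]
    rw [← this]
    rfl
  simp only [identitiesInVars, polynomialIdentities, Ideal.mem_comap, Ideal.mem_iInf,
    RingHom.mem_ker]
  constructor
  · intro h a
    have h1 := h fun m => if hm : m < d then a ⟨m, hm⟩ else 0
    have h2 := key fun m => if hm : m < d then a ⟨m, hm⟩ else 0
    rw [h2] at h1
    simpa using h1
  · intro h a
    rw [key]
    exact h _

theorem isInternal_relativelyFreeComponent (K : Type*) [Field K] [CharZero K] (R : Type*) [Ring R]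
    [Algebra K R] (d : ℕ) : DirectSum.IsInternal (relativelyFreeComponent K R d) := by
  classical
  let p : Fin d → ℕ := fun i => Nat.nth Nat.Prime i
  have hp : ∀ i, (p i).Prime := fun i => Nat.prime_nth_prime i
  have hpinj : Function.Injective p := fun i j h =>
    Fin.ext (Nat.nth_injective Nat.infinite_setOfPred_prime h)
  let ev : (Fin d →₀ ℕ) → K := fun n => ((∏ i, p i ^ n i : ℕ) : K)
  have hev : Function.Injective ev := by
    intro m n h
    have h' : (∏ i, p i ^ m i : ℕ) = ∏ i, p i ^ n i := Nat.cast_injective h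
    have hfac : ∀ (n : Fin d →₀ ℕ) (j : Fin d), (∏ i, p i ^ n i).factorization (p j) = n j := by
      intro n j
      rw [Nat.factorization_prod fun i _ => pow_ne_zero _ (hp i).ne_zero]
      simp [(hp _).factorization, Finsupp.single_apply, hpinj.eq_iff]
    ext j
    rw [← hfac m j, h', hfac n j]
  let s : FreeAlgebra K (Fin d) →ₐ[K] FreeAlgebra K (Fin d) :=
    FreeAlgebra.lift K fun i => (p i : K) • FreeAlgebra.ι K i
  have hs : ∀ f ∈ identitiesInVars K R d, s f ∈ identitiesInVars K R d := by
    intro f hf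
    rw [mem_identitiesInVars_iff] at hf ⊢
    intro a
    have : (FreeAlgebra.lift K a).comp s = FreeAlgebra.lift K fun i => (p i : K) • a i := by
      ext i
      simp [s]
    rw [← AlgHom.comp_apply, this]
    exact hf _
  let q := Ideal.Quotient.mkₐ K (identitiesInVars K R d)
  let φ : RelativelyFreeAlgebra K R d →ₐ[K] RelativelyFreeAlgebra K R d :=
    Ideal.Quotient.liftₐ _ (q.comp s) fun f hf => Ideal.Quotient.eq_zero_iff_mem.2 (hs f hf)
  have hφ : ∀ f, φ (q f) = q (s f) := fun f => rfl
  have hword : ∀ l : List (Fin d), s ((l.map (FreeAlgebra.ι K)).prod) =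
      ((∏ i, p i ^ l.count i : ℕ) : K) • (l.map (FreeAlgebra.ι K)).prod := by
    intro l
    induction l with
    | nil => simp
    | cons a l ih =>
      have : (∏ i, p i ^ (a :: l).count i) = p a * ∏ i, p i ^ l.count i := by
        simp only [List.count_cons, pow_add, Finset.prod_mul_distrib, beq_iff_eq]
        rw [mul_comm]
        congr 1
        simp [pow_ite, Finset.prod_ite_eq]
      rw [this, List.map_cons, List.prod_cons, map_mul, ih]
      simp only [s, FreeAlgebra.lift_ι_apply, Nat.cast_mul, mul_smul, smul_mul_assoc,
        mul_smul_comm]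
      exact smul_comm _ _ _
  have hle : ∀ n, relativelyFreeComponent K R d n ≤
      Module.End.eigenspace (φ.toLinearMap : Module.End K _) (ev n) := by
    intro n
    rw [relativelyFreeComponent, freeComponent, Submodule.map_span_le]
    rintro _ ⟨l, hl, rfl⟩
    rw [Module.End.mem_eigenspace_iff]
    change φ (q _) = ev n • q _
    rw [hφ, hword, map_smul]
    simp [ev, hl]
  refine DirectSum.isInternal_submodule_of_iSupIndep_of_iSup_eq_top ?_ ?_
  · exact ((Module.End.eigenspaces_iSupIndep (φ.toLinearMap : Module.End K _)).comp hev).mono hle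
  · rw [eq_top_iff]
    rintro x -
    obtain ⟨f, rfl⟩ := Ideal.Quotient.mk_surjective x
    change q f ∈ _
    have hf : f ∈ Submodule.span K (Set.range (FreeAlgebra.basisFreeMonoid K (Fin d))) := by
      rw [Module.Basis.span_eq]
      trivial
    have hw : ∀ l : List (Fin d), q ((l.map (FreeAlgebra.ι K)).prod) ∈
        ⨆ n, relativelyFreeComponent K R d n := by
      intro l
      refine Submodule.mem_iSup_of_mem (Finsupp.equivFunOnFinite.symm fun i => l.count i) ?_
      exact Submodule.mem_map_of_mem (Submodule.subset_span ⟨l, fun i => rfl, rfl⟩)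
    induction hf using Submodule.span_induction with
    | mem y hy =>
      obtain ⟨l, rfl⟩ := hy
      have : FreeAlgebra.basisFreeMonoid K (Fin d) l =
          (l.toList.map (FreeAlgebra.ι K)).prod := by
        simp [FreeAlgebra.basisFreeMonoid, FreeAlgebra.equivMonoidAlgebraFreeMonoid,
          FreeMonoid.lift_apply]
      rw [this]
      exact hw _
    | zero => simp
    | add y z _ _ hy hz => rw [map_add]; exact add_mem hy hz
    | smul c y _ hy => rw [map_smul]; exact Submodule.smul_mem _ c hy

/-! Put P = ∏ 1/(1 - t_i) and A = ∑ t_i - 1. Both formulas follow from H_0 = 0 and the recursion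
H_{k+1} = P + (1 + A P) H_k.

Let C be the kernel of the map from the free algebra to commutative polynomials. As a left module C
is free on the differences `straightener`, indexed by an exponent vector c and a variable i of c
other than the smallest; the maps `cofactor` are the coordinates. Spanning is
`eq_coeffSum_smul_add_sum`, independence is `cofactor_mul_straightener`, and 1 + A P is the
generating series of this basis.

The identities of U_{k+1} are the elements of C whose coordinates are all identities of U_k. One
inclusion is block multiplication (`mul_word_sub_word_mem_identitiesInVars`), the other an
evaluation at generic bordered matrices (`cofactor_mem_identitiesInVars`). So the component of
degree n for U_{k+1} is K, spanned by the sorted word, plus one copy of the component of degree n -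
c for U_k for each basis element of degree c ≤ n. Counting dimensions gives the recursion. -/

namespace UpperTriangularIdentities

/-! ### Power series: the coefficients of P and of 1 + A P. -/

section Series

open MvPowerSeries

/-- The variables occurring in the monomial `c`, other than the smallest one. -/
def nonMinVars {d : ℕ} (c : Fin d →₀ ℕ) : Finset (Fin d) :=
  Finset.univ.filter fun i => c i ≠ 0 ∧ ∃ p < i, c p ≠ 0

theorem mem_nonMinVars {d : ℕ} {c : Fin d →₀ ℕ} {i : Fin d} :
    i ∈ nonMinVars c ↔ c i ≠ 0 ∧ ∃ p < i, c p ≠ 0 := by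
  simp [nonMinVars]

theorem card_nonMinVars_add_one {d : ℕ} {c : Fin d →₀ ℕ} (hc : c ≠ 0) :
    (nonMinVars c).card + 1 = c.support.card := by
  have hne : c.support.Nonempty := Finsupp.support_nonempty_iff.2 hc
  have h : nonMinVars c = c.support.erase (c.support.min' hne) := by
    ext i
    simp only [mem_nonMinVars, Finset.mem_erase, Finsupp.mem_support_iff]
    constructor
    · rintro ⟨hi, p, hp, hcp⟩
      refine ⟨fun h => ?_, hi⟩
      have := c.support.min'_le p (by simpa using hcp)
      rw [← h] at this
      exact absurd hp (not_lt.2 this)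
    · rintro ⟨h, hi⟩
      refine ⟨hi, _, lt_of_le_of_ne (c.support.min'_le i (by simpa using hi)) (Ne.symm h), ?_⟩
      simpa using c.support.min'_mem hne
  rw [h, Finset.card_erase_add_one (c.support.min'_mem hne)]

theorem coeff_X_mul_eq_ite {σ R : Type*} [Semiring R] [DecidableEq σ] (i : σ)
    (φ : MvPowerSeries σ R) (n : σ →₀ ℕ) :
    coeff n (X i * φ) = if n i ≠ 0 then coeff (n - Finsupp.single i 1) φ else 0 := by
  classical
  rw [X, coeff_monomial_mul]
  simp [Nat.one_le_iff_ne_zero]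

theorem constantCoeff_one_sub_X_ne_zero {d : ℕ} (i : Fin d) :
    constantCoeff (1 - X i : MvPowerSeries (Fin d) ℚ) ≠ 0 := by
  simp

theorem coeff_prod_inv_one_sub_X {d : ℕ} (s : Finset (Fin d)) (n : Fin d →₀ ℕ) :
    coeff n (∏ i ∈ s, (1 - X i : MvPowerSeries (Fin d) ℚ)⁻¹) =
      if n.support ⊆ s then 1 else 0 := by
  induction s using Finset.induction_on generalizing n with
  | empty =>
    classical
    simp [coeff_one]
  | insert a s ha ih =>
    -- The expected answer is verified after multiplying by `1 - X a`: the coefficients at `n` and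
    -- `n - single a 1` cancel whenever `a` occurs in `n`.
    let φ : MvPowerSeries (Fin d) ℚ := fun n => if n.support ⊆ insert a s then 1 else 0
    have hφ : ∀ n, coeff n φ = if n.support ⊆ insert a s then 1 else 0 := fun n => rfl
    suffices h : φ = (∏ i ∈ s, (1 - X i)⁻¹) * (1 - X a)⁻¹ by
      rw [Finset.prod_insert ha, mul_comm, ← h, hφ]
    rw [MvPowerSeries.eq_mul_inv_iff_mul_eq (constantCoeff_one_sub_X_ne_zero a)]
    ext n
    rw [ih, mul_comm, sub_mul, one_mul, map_sub, coeff_X_mul_eq_ite, hφ, hφ]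
    by_cases hn : n a = 0
    · have : n.support ⊆ insert a s ↔ n.support ⊆ s := by
        rw [Finset.subset_insert_iff_of_notMem (by simpa using hn)]
      simp [hn, this]
    · have h1 : (n - Finsupp.single a 1).support ⊆ insert a s ↔ n.support ⊆ insert a s := by
        simp only [Finset.subset_iff, Finsupp.mem_support_iff, Finset.mem_insert]
        refine forall_congr' fun x => ?_
        by_cases hx : x = a
        · simp [hx]
        · simp [hx]
      have h2 : ¬ n.support ⊆ s := fun h => ha (h (by simpa using hn))
      simp [hn, h1, h2]

theorem coeff_prod_univ_inv_one_sub_X {d : ℕ} (n : Fin d →₀ ℕ) :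
    coeff n (∏ i, (1 - X i : MvPowerSeries (Fin d) ℚ)⁻¹) = 1 := by
  rw [coeff_prod_inv_one_sub_X, if_pos (Finset.subset_univ _)]

/-- The product of ∑ t_i with P counts the variables of `n`, and subtracting P removes the smallest
one. For `n = 0` there is none to remove, and the summand 1 compensates. -/
theorem coeff_one_add_sum_X_sub_one_mul {d : ℕ} (n : Fin d →₀ ℕ) :
    coeff n (1 + ((∑ i : Fin d, X i) - 1) * ∏ i, (1 - X i)⁻¹ : MvPowerSeries (Fin d) ℚ) =
      (nonMinVars n).card := by
  classical
  rw [sub_mul, one_mul, Finset.sum_mul, map_add, map_sub, map_sum, coeff_one,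
    coeff_prod_univ_inv_one_sub_X]
  simp only [coeff_X_mul_eq_ite, coeff_prod_univ_inv_one_sub_X]
  rw [Finset.sum_ite, Finset.sum_const_zero, add_zero, Finset.sum_const, nsmul_eq_mul, mul_one]
  have hs : (Finset.univ.filter fun i => n i ≠ 0) = n.support := by ext; simp
  rw [hs]
  by_cases hn : n = 0
  · subst hn
    simp [nonMinVars]
  · rw [if_neg hn, ← card_nonMinVars_add_one hn]
    push_cast
    ring

/-- A sequence with `H₀ = 0` and `H_{k+1} = P + (1 + A P) H_k` satisfies
`A H_k = (1 + A P) ^ k - 1`. -/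
theorem mul_eq_pow_sub_one_of_recursion {R : Type*} [CommRing R] {A P : R} {H : ℕ → R}
    (h0 : H 0 = 0) (hs : ∀ k, H (k + 1) = P + (1 + A * P) * H k) (k : ℕ) :
    A * H k = (1 + A * P) ^ k - 1 := by
  induction k with
  | zero => simp [h0]
  | succ k ih =>
    rw [hs, pow_succ]
    linear_combination (1 + A * P) * ih

theorem mul_sum_Icc_choose {R : Type*} [CommRing R] (A P : R) (k : ℕ) :
    A * ∑ j ∈ Finset.Icc 1 k, (k.choose j : R) * P ^ j * A ^ (j - 1) = (1 + A * P) ^ k - 1 := by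
  rw [add_comm 1, add_pow, Finset.sum_range_succ', Finset.mul_sum]
  simp only [pow_zero, one_pow, mul_one, Nat.choose_zero_right, Nat.cast_one, add_sub_cancel_right]
  rw [← Finset.Ico_add_one_right_eq_Icc, Finset.sum_Ico_eq_sum_range]
  refine Finset.sum_congr rfl fun j _ => ?_
  rw [Nat.add_sub_cancel_left, add_comm 1 j]
  ring

theorem constantCoeff_sum_X_sub_one_ne_zero (d : ℕ) :
    constantCoeff ((∑ i : Fin d, X i) - 1 : MvPowerSeries (Fin d) ℚ) ≠ 0 := by
  simp [map_sum]

end Series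

end UpperTriangularIdentities

namespace UpperTriangularIdentities

/-! ### Words: sorted words, straighteners and cofactors. -/

section Words

variable {d : ℕ}

/-- The exponent vector of a word. -/
noncomputable def content (l : List (Fin d)) : Fin d →₀ ℕ :=
  Multiset.toFinsupp (l : Multiset (Fin d))

theorem content_apply (l : List (Fin d)) (i : Fin d) : content l i = l.count i := by
  simp [content]

@[simp]
theorem content_nil : content ([] : List (Fin d)) = 0 := by
  simp [content]

theorem content_cons (j : Fin d) (l : List (Fin d)) :
    content (j :: l) = Finsupp.single j 1 + content l := by
  rw [content, ← Multiset.cons_coe, ← Multiset.singleton_add, Multiset.toFinsupp_add,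
    Multiset.toFinsupp_singleton, content]

theorem content_append (l m : List (Fin d)) : content (l ++ m) = content l + content m := by
  simp [content, ← Multiset.coe_add]

theorem content_eq_iff {l m : List (Fin d)} : content l = content m ↔ l.Perm m := by
  simp [content]

/-- The weakly increasing word with a given exponent vector. -/
noncomputable def sortedWord (c : Fin d →₀ ℕ) : List (Fin d) :=
  (Finsupp.toMultiset c).sort (· ≤ ·)

theorem content_sortedWord (c : Fin d →₀ ℕ) : content (sortedWord c) = c := by
  simp [content, sortedWord]

theorem pairwise_sortedWord (c : Fin d →₀ ℕ) : (sortedWord c).Pairwise (· ≤ ·) :=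
  Multiset.pairwise_sort _ _

theorem eq_sortedWord {l : List (Fin d)} (h : l.Pairwise (· ≤ ·)) : l = sortedWord (content l) :=
  (content_eq_iff.1 (content_sortedWord (content l)).symm).eq_of_pairwise' h
    (pairwise_sortedWord _)

theorem mem_iff_content_ne_zero {l : List (Fin d)} {i : Fin d} : i ∈ l ↔ content l i ≠ 0 := by
  rw [content_apply, ← List.count_pos_iff, Nat.pos_iff_ne_zero]

/-- With no smaller letter behind it, `j` may be put in front without spoiling the order. This is
why only non-minimal variables index straighteners. -/
theorem cons_sortedWord_of_notMem {j : Fin d} {c : Fin d →₀ ℕ}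
    (h : j ∉ nonMinVars (Finsupp.single j 1 + c)) :
    j :: sortedWord c = sortedWord (Finsupp.single j 1 + c) := by
  have hs : (j :: sortedWord c).Pairwise (· ≤ ·) := by
    refine List.pairwise_cons.2 ⟨fun p hp => ?_, pairwise_sortedWord c⟩
    by_contra! hlt
    rw [mem_iff_content_ne_zero, content_sortedWord] at hp
    exact h (mem_nonMinVars.2 ⟨by simp, p, hlt, by simp [hp]⟩)
  conv_lhs => rw [eq_sortedWord hs, content_cons, content_sortedWord]

variable (K : Type*) [Field K]

/-- The monomial of the free algebra with a given list of letters. -/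
noncomputable def word (l : List (Fin d)) : FreeAlgebra K (Fin d) :=
  (l.map (FreeAlgebra.ι K)).prod

@[simp]
theorem word_nil : word K ([] : List (Fin d)) = 1 := by
  simp [word]

theorem word_cons (j : Fin d) (l : List (Fin d)) :
    word K (j :: l) = FreeAlgebra.ι K j * word K l := by
  simp [word]

theorem word_append (l m : List (Fin d)) : word K (l ++ m) = word K l * word K m := by
  simp [word]

/-- The words form a basis of the free algebra. -/
noncomputable def wordBasis (d : ℕ) : Module.Basis (List (Fin d)) K (FreeAlgebra K (Fin d)) :=
  (FreeAlgebra.basisFreeMonoid K (Fin d)).reindex FreeMonoid.toList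

theorem wordBasis_apply (l : List (Fin d)) : wordBasis K d l = word K l := by
  simp [wordBasis, word, FreeAlgebra.basisFreeMonoid,
    FreeAlgebra.equivMonoidAlgebraFreeMonoid, FreeMonoid.lift_apply]

variable {K}

theorem linearMap_ext_word {M : Type*} [AddCommMonoid M] [Module K M]
    {f g : FreeAlgebra K (Fin d) →ₗ[K] M} (h : ∀ l, f (word K l) = g (word K l)) : f = g :=
  (wordBasis K d).ext fun l => by simpa [wordBasis_apply] using h l

theorem freeComponent_eq_span (n : Fin d →₀ ℕ) :
    freeComponent K d n = Submodule.span K (word K '' {l | content l = n}) := by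
  simp only [freeComponent, word, Finsupp.ext_iff, content_apply]
  rfl

theorem word_mem_freeComponent (l : List (Fin d)) : word K l ∈ freeComponent K d (content l) := by
  rw [freeComponent_eq_span]
  exact Submodule.subset_span ⟨l, rfl, rfl⟩

theorem mul_mem_freeComponent {f g : FreeAlgebra K (Fin d)} {m n : Fin d →₀ ℕ}
    (hf : f ∈ freeComponent K d m) (hg : g ∈ freeComponent K d n) :
    f * g ∈ freeComponent K d (m + n) := by
  rw [freeComponent_eq_span] at hf hg
  have := Submodule.mul_mem_mul hf hg
  rw [Submodule.span_mul_span] at this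
  refine Submodule.span_le.2 ?_ this
  rintro _ ⟨_, ⟨l, rfl, rfl⟩, _, ⟨l', rfl, rfl⟩, rfl⟩
  simpa [word_append, content_append] using word_mem_freeComponent (K := K) (l ++ l')

variable (K)

/-- On words: the prefix `u` if the word is `u x_i s` with `x_i s` of content `c`, and `0` if there
is no such decomposition. -/
noncomputable def cofactorWord (i : Fin d) (c : Fin d →₀ ℕ) :
    List (Fin d) → FreeAlgebra K (Fin d)
  | [] => 0
  | j :: l => FreeAlgebra.ι K j * cofactorWord i c l + if j = i ∧ content (j :: l) = c then 1 else 0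

/-- The linear map sending a word `u x_i s`, with `x_i s` of content `c`, to `u`, and the words
without such a decomposition to `0`. -/
noncomputable def cofactor (i : Fin d) (c : Fin d →₀ ℕ) :
    FreeAlgebra K (Fin d) →ₗ[K] FreeAlgebra K (Fin d) :=
  (wordBasis K d).constr K (cofactorWord K i c)

variable {K}

theorem cofactor_word (i : Fin d) (c : Fin d →₀ ℕ) (l : List (Fin d)) :
    cofactor K i c (word K l) = cofactorWord K i c l := by
  rw [cofactor, ← wordBasis_apply, Module.Basis.constr_basis]

theorem cofactorWord_eq_zero_or (i : Fin d) (c : Fin d →₀ ℕ) (l : List (Fin d)) :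
    cofactorWord K i c l = 0 ∨
      ∃ u, cofactorWord K i c l = word K u ∧ content u + c = content l := by
  induction l with
  | nil => exact Or.inl rfl
  | cons j l ih =>
    rw [cofactorWord]
    rcases ih with h | ⟨u, hu, huc⟩
    · rw [h, mul_zero, zero_add]
      split_ifs with hj
      · exact Or.inr ⟨[], by simp [hj.2]⟩
      · exact Or.inl rfl
    · refine Or.inr ⟨j :: u, ?_, by rw [content_cons, content_cons, add_assoc, huc]⟩
      rw [if_neg, hu, word_cons, add_zero]
      -- Two suffixes of different lengths cannot both have content `c`, so the decomposition is
      -- unique and the two summands never occur together.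
      rintro ⟨-, h⟩
      rw [← h, content_cons, ← add_assoc, add_eq_right] at huc
      simpa using DFunLike.congr_fun huc j

theorem cofactor_mem_freeComponent (i : Fin d) {c m n : Fin d →₀ ℕ} (h : c + m = n)
    {f : FreeAlgebra K (Fin d)} (hf : f ∈ freeComponent K d n) :
    cofactor K i c f ∈ freeComponent K d m := by
  rw [freeComponent_eq_span] at hf
  have : freeComponent K d n ≤ (freeComponent K d m).comap (cofactor K i c) := by
    rw [freeComponent_eq_span, Submodule.span_le]
    rintro _ ⟨l, hl, rfl⟩
    rw [SetLike.mem_coe, Submodule.mem_comap, cofactor_word]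
    rcases cofactorWord_eq_zero_or (K := K) i c l with h' | ⟨u, hu, huc⟩
    · rw [h']
      exact zero_mem _
    · rw [hu]
      have : content u = m := by
        rw [Set.mem_ofPred_eq] at hl
        rw [hl, ← h, add_comm, add_left_cancel_iff] at huc
        exact huc
      exact this ▸ word_mem_freeComponent u
  exact this (by rwa [freeComponent_eq_span])

/-- A cut inside `u` sees the tail only through its content, which `s` and `t` share; such cuts
cancel in the difference. -/
theorem cofactorWord_append_sub (i : Fin d) (c : Fin d →₀ ℕ) (u : List (Fin d))
    {s t : List (Fin d)} (h : s.Perm t) :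
    cofactorWord K i c (u ++ s) - cofactorWord K i c (u ++ t) =
      word K u * (cofactorWord K i c s - cofactorWord K i c t) := by
  induction u with
  | nil => simp
  | cons j u ih =>
    have hc : content (j :: (u ++ s)) = content (j :: (u ++ t)) :=
      content_eq_iff.2 ((h.append_left u).cons j)
    rw [List.cons_append, List.cons_append, cofactorWord, cofactorWord, hc, word_cons, mul_assoc,
      ← ih]
    noncomm_ring

theorem cofactor_mul_word_sub_word (i : Fin d) (c : Fin d →₀ ℕ) (f : FreeAlgebra K (Fin d))
    {s t : List (Fin d)} (h : s.Perm t) :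
    cofactor K i c (f * (word K s - word K t)) =
      f * (cofactorWord K i c s - cofactorWord K i c t) := by
  have : (cofactor K i c).comp (LinearMap.mulRight K (word K s - word K t)) =
      LinearMap.mulRight K (cofactorWord K i c s - cofactorWord K i c t) := by
    refine linearMap_ext_word fun l => ?_
    rw [LinearMap.comp_apply, LinearMap.mulRight_apply, LinearMap.mulRight_apply, mul_sub,
      ← word_append, ← word_append, map_sub, cofactor_word, cofactor_word,
      cofactorWord_append_sub i c l h]
  exact LinearMap.congr_fun this f

/-- A suffix of content `c` starting with `i` would contain a smaller letter after `i`. -/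
theorem cofactorWord_eq_zero_of_pairwise {i : Fin d} {c : Fin d →₀ ℕ} (hi : i ∈ nonMinVars c)
    {l : List (Fin d)} (hl : l.Pairwise (· ≤ ·)) : cofactorWord K i c l = 0 := by
  induction l with
  | nil => rfl
  | cons j l ih =>
    rw [List.pairwise_cons] at hl
    rw [cofactorWord, ih hl.2, mul_zero, zero_add, if_neg]
    rintro ⟨rfl, rfl⟩
    obtain ⟨-, p, hp, hc⟩ := mem_nonMinVars.1 hi
    rcases List.mem_cons.1 (mem_iff_content_ne_zero.2 hc) with rfl | h
    · exact lt_irrefl _ hp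
    · exact absurd hp (not_lt.2 (hl.1 p h))

variable (K)

/-- The difference of the words `x_i s` and `t` of content `c`, where `s` and `t` are weakly
increasing. -/
noncomputable def straightener (i : Fin d) (c : Fin d →₀ ℕ) : FreeAlgebra K (Fin d) :=
  word K (i :: sortedWord (c - Finsupp.single i 1)) - word K (sortedWord c)

variable {K}

theorem single_add_tsub_of_mem_nonMinVars {i : Fin d} {c : Fin d →₀ ℕ} (hi : i ∈ nonMinVars c) :
    Finsupp.single i 1 + (c - Finsupp.single i 1) = c :=
  add_tsub_cancel_of_le <|
    Finsupp.single_le_iff.2 (Nat.one_le_iff_ne_zero.2 (mem_nonMinVars.1 hi).1)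

theorem content_cons_sortedWord_tsub {i : Fin d} {c : Fin d →₀ ℕ} (hi : i ∈ nonMinVars c) :
    content (i :: sortedWord (c - Finsupp.single i 1)) = c := by
  rw [content_cons, content_sortedWord, single_add_tsub_of_mem_nonMinVars hi]

theorem cons_sortedWord_perm {i : Fin d} {c : Fin d →₀ ℕ} (hi : i ∈ nonMinVars c) :
    (i :: sortedWord (c - Finsupp.single i 1)).Perm (sortedWord c) := by
  rw [← content_eq_iff, content_cons_sortedWord_tsub hi, content_sortedWord]

theorem straightener_mem_freeComponent {i : Fin d} {c : Fin d →₀ ℕ} (hi : i ∈ nonMinVars c) :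
    straightener K i c ∈ freeComponent K d c := by
  have h1 := word_mem_freeComponent (K := K) (i :: sortedWord (c - Finsupp.single i 1))
  have h2 := word_mem_freeComponent (K := K) (sortedWord c)
  rw [content_cons_sortedWord_tsub hi] at h1
  rw [content_sortedWord] at h2
  exact Submodule.sub_mem _ h1 h2

/-- Sorted words have no cofactors, so the only possible cut is in front of the leading letter of
the straightener. This duality makes the straighteners left independent. -/
theorem cofactor_mul_straightener {i j : Fin d} {c m : Fin d →₀ ℕ} (hi : i ∈ nonMinVars c)
    (hj : j ∈ nonMinVars m) (f : FreeAlgebra K (Fin d)) :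
    cofactor K i c (f * straightener K j m) = if j = i ∧ m = c then f else 0 := by
  rw [straightener, cofactor_mul_word_sub_word _ _ _ (cons_sortedWord_perm hj), cofactorWord,
    cofactorWord_eq_zero_of_pairwise hi (pairwise_sortedWord _),
    cofactorWord_eq_zero_of_pairwise hi (pairwise_sortedWord _), content_cons_sortedWord_tsub hj]
  split_ifs <;> simp

theorem cofactor_word_sortedWord {i : Fin d} {c : Fin d →₀ ℕ} (hi : i ∈ nonMinVars c)
    (n : Fin d →₀ ℕ) : cofactor K i c (word K (sortedWord n)) = 0 := by
  rw [cofactor_word, cofactorWord_eq_zero_of_pairwise hi (pairwise_sortedWord _)]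

/-- Sort the word from its right end: each new letter in front of a sorted tail costs one
straightener, or nothing if it is minimal. Assuming only `content l ≤ n` keeps the range of
summation fixed during the induction. -/
theorem word_eq_sortedWord_add_sum {n : Fin d →₀ ℕ} (l : List (Fin d)) (hl : content l ≤ n) :
    word K l = word K (sortedWord (content l)) +
      ∑ x ∈ Finset.HasAntidiagonal.antidiagonal n, ∑ i ∈ nonMinVars x.1,
        cofactorWord K i x.1 l * straightener K i x.1 := by
  induction l with
  | nil => simp [cofactorWord, sortedWord]
  | cons j l ih =>
    have hl' : content l ≤ n := le_trans (by rw [content_cons]; exact le_add_self) hl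
    have h1 : ∑ x ∈ Finset.HasAntidiagonal.antidiagonal n, ∑ i ∈ nonMinVars x.1,
        (if j = i ∧ content (j :: l) = x.1 then 1 else 0) * straightener K i x.1 =
        word K (j :: sortedWord (content l)) - word K (sortedWord (content (j :: l))) := by
      rw [Finset.sum_eq_single (content (j :: l), n - content (j :: l))]
      · by_cases hj : j ∈ nonMinVars (content (j :: l))
        · rw [Finset.sum_eq_single_of_mem j hj]
          · simp only [and_self, if_true, one_mul]
            rw [straightener, content_cons, add_tsub_cancel_left]
          · intro i _ hij
            simp [Ne.symm hij]
        · rw [Finset.sum_eq_zero]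
          · rw [content_cons] at hj ⊢
            rw [cons_sortedWord_of_notMem hj, sub_self]
          · intro i hi
            rw [if_neg, zero_mul]
            rintro ⟨rfl, -⟩
            exact hj hi
      · intro x hx hne
        refine Finset.sum_eq_zero fun i _ => ?_
        rw [if_neg, zero_mul]
        rintro ⟨-, h⟩
        refine hne (Prod.ext h.symm ?_)
        rw [← Finset.HasAntidiagonal.mem_antidiagonal.1 hx, h, add_tsub_cancel_left]
      · intro h
        exact absurd (Finset.HasAntidiagonal.mem_antidiagonal.2 (add_tsub_cancel_of_le hl)) h
    simp only [cofactorWord, add_mul, Finset.sum_add_distrib, h1, mul_assoc, ← Finset.mul_sum]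
    rw [word_cons, word_cons, eq_sub_of_add_eq' (ih hl').symm]
    noncomm_ring

variable (K d)

/-- The sum of the coefficients of an element of the free algebra. -/
noncomputable def coeffSum : FreeAlgebra K (Fin d) →ₐ[K] K :=
  FreeAlgebra.lift K fun _ => 1

variable {K d}

@[simp]
theorem coeffSum_word (l : List (Fin d)) : coeffSum d K (word K l) = 1 := by
  induction l with
  | nil => simp
  | cons j l ih => rw [word_cons, map_mul, ih, coeffSum, FreeAlgebra.lift_ι_apply, mul_one]

theorem coeffSum_straightener (i : Fin d) (c : Fin d →₀ ℕ) :
    coeffSum d K (straightener K i c) = 0 := by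
  simp [straightener]

theorem eq_coeffSum_smul_add_sum {n : Fin d →₀ ℕ} {f : FreeAlgebra K (Fin d)}
    (h : f ∈ freeComponent K d n) :
    f = coeffSum d K f • word K (sortedWord n) +
      ∑ x ∈ Finset.HasAntidiagonal.antidiagonal n, ∑ i ∈ nonMinVars x.1,
        cofactor K i x.1 f * straightener K i x.1 := by
  have hf := h
  rw [freeComponent_eq_span] at hf
  clear h
  induction hf using Submodule.span_induction with
  | mem y hy =>
    obtain ⟨l, rfl, rfl⟩ := hy
    simpa [cofactor_word] using word_eq_sortedWord_add_sum (K := K) l le_rfl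
  | zero => simp
  | add y z _ _ hy hz =>
    conv_lhs => rw [hy, hz]
    simp only [map_add, add_smul, add_mul, Finset.sum_add_distrib]
    abel
  | smul a y _ hy =>
    conv_lhs => rw [hy]
    simp only [map_smul, smul_add, smul_eq_mul, mul_smul, smul_mul_assoc, Finset.smul_sum]

end Words

end UpperTriangularIdentities

namespace UpperTriangularIdentities

/-! ### Matrices: how the identities of U_{k+1} and of U_k determine each other. -/

section Matrices

variable {d : ℕ} {K : Type*} [Field K]

theorem mem_identitiesInVars_upperTriangular_iff {k : ℕ} {f : FreeAlgebra K (Fin d)} :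
    f ∈ identitiesInVars K (upperTriangularAlgebra K k) d ↔
      ∀ a : Fin d → Matrix (Fin k) (Fin k) K, (∀ i, (a i).BlockTriangular id) →
        FreeAlgebra.lift K a f = 0 := by
  have key : ∀ a : Fin d → upperTriangularAlgebra K k,
      FreeAlgebra.lift K (fun i => (a i : Matrix (Fin k) (Fin k) K)) f =
        (FreeAlgebra.lift K a f : Matrix (Fin k) (Fin k) K) := by
    intro a
    have : (upperTriangularAlgebra K k).val.comp (FreeAlgebra.lift K a) =
        FreeAlgebra.lift K (fun i => (a i : Matrix (Fin k) (Fin k) K)) := by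
      refine FreeAlgebra.hom_ext (funext fun i => ?_)
      simp
    rw [← this]
    rfl
  rw [mem_identitiesInVars_iff]
  constructor
  · intro h a ha
    rw [key fun i => ⟨a i, ha i⟩, h]
    rfl
  · intro h a
    exact Subtype.ext ((key a).symm.trans (h _ fun i => (a i).2))

theorem lift_blockTriangular {k : ℕ} {a : Fin d → Matrix (Fin k) (Fin k) K}
    (ha : ∀ i, (a i).BlockTriangular id) (f : FreeAlgebra K (Fin d)) :
    (FreeAlgebra.lift K a f).BlockTriangular id := by
  induction f using FreeAlgebra.induction with
  | grade0 r =>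
    rw [AlgHom.commutes]
    exact Matrix.blockTriangular_algebraMap r
  | grade1 i => simpa using ha i
  | mul x y hx hy => rw [map_mul]; exact hx.mul hy
  | add x y hx hy => rw [map_add]; exact hx.add hy

theorem BlockTriangular.last_castSucc {R : Type*} [Zero R] {k : ℕ}
    {M : Matrix (Fin (k + 1)) (Fin (k + 1)) R} (hM : M.BlockTriangular id) (q : Fin k) :
    M (Fin.last k) q.castSucc = 0 :=
  hM (Fin.castSucc_lt_last q)

/-- The upper left corner of the value of `f` at upper triangular matrices is the value at the
corners. -/
theorem lift_castSucc_castSucc {k : ℕ} {a : Fin d → Matrix (Fin (k + 1)) (Fin (k + 1)) K}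
    (ha : ∀ i, (a i).BlockTriangular id) (f : FreeAlgebra K (Fin d)) (p q : Fin k) :
    FreeAlgebra.lift K a f p.castSucc q.castSucc =
      FreeAlgebra.lift K (fun i => (a i).submatrix Fin.castSucc Fin.castSucc) f p q := by
  induction f using FreeAlgebra.induction generalizing p q with
  | grade0 r => simp [Matrix.algebraMap_matrix_apply]
  | grade1 i => simp
  | mul x y hx hy =>
    rw [map_mul, map_mul, Matrix.mul_apply, Matrix.mul_apply, Fin.sum_univ_castSucc,
      BlockTriangular.last_castSucc (lift_blockTriangular ha y), mul_zero, add_zero]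
    simp only [hx, hy]
  | add x y hx hy => simp [hx, hy]

theorem lift_last_last_word {k : ℕ} {a : Fin d → Matrix (Fin (k + 1)) (Fin (k + 1)) K}
    (ha : ∀ i, (a i).BlockTriangular id) (l : List (Fin d)) :
    FreeAlgebra.lift K a (word K l) (Fin.last k) (Fin.last k) =
      (l.map fun i => a i (Fin.last k) (Fin.last k)).prod := by
  induction l with
  | nil => simp
  | cons j l ih =>
    rw [word_cons, map_mul, Matrix.mul_apply, Fin.sum_univ_castSucc, Finset.sum_eq_zero, zero_add,
      ih, FreeAlgebra.lift_ι_apply, List.map_cons, List.prod_cons]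
    intro q _
    rw [FreeAlgebra.lift_ι_apply, BlockTriangular.last_castSucc (ha j), zero_mul]

/-- The value of `f` vanishes outside its last column, since its upper left corner is a value on
U_k. The last row of the other factor vanishes, because its corner entry is a difference of equal
products of scalars. -/
theorem mul_word_sub_word_mem_identitiesInVars {k : ℕ} {f : FreeAlgebra K (Fin d)}
    (hf : f ∈ identitiesInVars K (upperTriangularAlgebra K k) d) {s t : List (Fin d)}
    (h : s.Perm t) :
    f * (word K s - word K t) ∈ identitiesInVars K (upperTriangularAlgebra K (k + 1)) d := by
  rw [mem_identitiesInVars_upperTriangular_iff] at hf ⊢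
  intro a ha
  have hv : FreeAlgebra.lift K a (word K s - word K t) (Fin.last k) (Fin.last k) = 0 := by
    rw [map_sub, Matrix.sub_apply, lift_last_last_word ha, lift_last_last_word ha,
      (h.map _).prod_eq, sub_self]
  have hc : ∀ p q : Fin k, FreeAlgebra.lift K a f p.castSucc q.castSucc = 0 := by
    intro p q
    rw [lift_castSucc_castSucc ha]
    exact congrFun (congrFun (hf _ fun i x y hxy => ha i (Fin.castSucc_lt_castSucc_iff.2 hxy)) p) q
  ext p q
  rw [map_mul, Matrix.mul_apply, Fin.sum_univ_castSucc, Matrix.zero_apply]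
  have h1 : FreeAlgebra.lift K a (word K s - word K t) (Fin.last k) q = 0 := by
    induction q using Fin.lastCases with
    | last => exact hv
    | cast q => exact BlockTriangular.last_castSucc (lift_blockTriangular ha _) q
  rw [h1, mul_zero, add_zero]
  refine Finset.sum_eq_zero fun r _ => ?_
  induction p using Fin.lastCases with
  | last => rw [BlockTriangular.last_castSucc (lift_blockTriangular ha f), zero_mul]
  | cast p => rw [hc, zero_mul]

theorem coeffSum_eq_zero_of_mem_identitiesInVars {k : ℕ} {f : FreeAlgebra K (Fin d)}
    (hf : f ∈ identitiesInVars K (upperTriangularAlgebra K (k + 1)) d) : coeffSum d K f = 0 := by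
  rw [mem_identitiesInVars_iff] at hf
  have h : FreeAlgebra.lift K (fun _ : Fin d => (1 : upperTriangularAlgebra K (k + 1))) =
      (Algebra.ofId K (upperTriangularAlgebra K (k + 1))).comp (coeffSum d K) := by
    refine FreeAlgebra.hom_ext (funext fun i => ?_)
    simp [coeffSum]
  -- Substituting the identity matrix for every variable gives `coeffSum` as a scalar matrix, of
  -- positive size `k + 1`.
  have h1 := hf fun _ => 1
  rw [h] at h1
  exact (map_eq_zero_iff _ (FaithfulSMul.algebraMap_injective K _)).1 h1

/-- The matrix with upper left corner `M`, last column `v`, and `s` at the lower right end. -/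
def bordered {R : Type*} [Zero R] {k : ℕ} (M : Matrix (Fin k) (Fin k) R) (v : Fin k → R) (s : R) :
    Matrix (Fin (k + 1)) (Fin (k + 1)) R :=
  Matrix.of fun p => Fin.lastCases (Fin.lastCases s (fun _ => 0))
    (fun p' => Fin.lastCases (v p') (M p')) p

section Bordered

variable {R : Type*} [Zero R] {k : ℕ} (M : Matrix (Fin k) (Fin k) R) (v : Fin k → R) (s : R)

@[simp]
theorem bordered_last_last : bordered M v s (Fin.last k) (Fin.last k) = s := by
  simp [bordered]

@[simp]
theorem bordered_last_castSucc (q : Fin k) : bordered M v s (Fin.last k) q.castSucc = 0 := by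
  simp [bordered]

@[simp]
theorem bordered_castSucc_last (p : Fin k) : bordered M v s p.castSucc (Fin.last k) = v p := by
  simp [bordered]

@[simp]
theorem bordered_castSucc_castSucc (p q : Fin k) :
    bordered M v s p.castSucc q.castSucc = M p q := by
  simp [bordered]

end Bordered

theorem bordered_blockTriangular {R : Type*} [Zero R] {k : ℕ} {M : Matrix (Fin k) (Fin k) R}
    (hM : M.BlockTriangular id) (v : Fin k → R) (s : R) :
    (bordered M v s).BlockTriangular id := by
  intro p q hpq
  induction p using Fin.lastCases with
  | last =>
    induction q using Fin.lastCases with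
    | last => exact absurd hpq (lt_irrefl _)
    | cast q => simp
  | cast p =>
    induction q using Fin.lastCases with
    | last => exact absurd hpq (not_lt.2 (Fin.le_last _))
    | cast q => simpa using hM (by simpa using hpq)

/-! ### Generic bordered matrices. -/

section Generic

open MvPolynomial

/-- The matrices bordering `a j` by indeterminates on the diagonal and by a column which vanishes
unless `j = i`. -/
noncomputable def genericBordered {k : ℕ} (a : Fin d → Matrix (Fin k) (Fin k) K) (v : Fin k → K)
    (i j : Fin d) : Matrix (Fin (k + 1)) (Fin (k + 1)) (MvPolynomial (Fin d) K) :=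
  bordered ((a j).map C) (fun p => if j = i then C (v p) * X i else 0) (X j)

theorem lift_genericBordered_last_word {k : ℕ} (a : Fin d → Matrix (Fin k) (Fin k) K)
    (v : Fin k → K) (i : Fin d) (l : List (Fin d)) :
    FreeAlgebra.lift K (genericBordered a v i) (word K l) (Fin.last k) (Fin.last k) =
      monomial (content l) 1 := by
  induction l with
  | nil => simp
  | cons j l ih =>
    rw [word_cons, map_mul, Matrix.mul_apply, Fin.sum_univ_castSucc, ih, FreeAlgebra.lift_ι_apply,
      content_cons, genericBordered]
    simp [X, monomial_mul]

/-- A path into the last column cuts the word as u x_i s: u acts through `a`, x_i contributes `v`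
times `X i`, and s contributes the monomial of its content. The factor `X i` makes the exponent
record x_i s rather than s alone. -/
theorem coeff_lift_genericBordered_word {k : ℕ} (a : Fin d → Matrix (Fin k) (Fin k) K)
    (v : Fin k → K) (i : Fin d) (c : Fin d →₀ ℕ) (l : List (Fin d)) (p : Fin k) :
    coeff c (FreeAlgebra.lift K (genericBordered a v i) (word K l) p.castSucc (Fin.last k)) =
      (FreeAlgebra.lift K a (cofactorWord K i c l)).mulVec v p := by
  induction l generalizing p with
  | nil => simp [cofactorWord, (Fin.castSucc_lt_last p).ne]
  | cons j l ih =>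
    have h : coeff c ((if j = i then C (v p) * X i else 0) * monomial (content l) (1 : K)) =
        if j = i ∧ content (j :: l) = c then v p else 0 := by
      by_cases hj : j = i
      · subst hj
        rw [if_pos rfl, content_cons, mul_assoc, X, monomial_mul, coeff_C_mul, coeff_monomial]
        simp
      · simp [hj]
    rw [word_cons, map_mul, Matrix.mul_apply, Fin.sum_univ_castSucc,
      lift_genericBordered_last_word, FreeAlgebra.lift_ι_apply, cofactorWord, map_add, map_mul,
      FreeAlgebra.lift_ι_apply, Matrix.add_mulVec, ← Matrix.mulVec_mulVec]
    simp only [genericBordered, bordered_castSucc_castSucc, bordered_castSucc_last, Matrix.map_apply,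
      coeff_add, coeff_sum, coeff_C_mul, h, Pi.add_apply]
    congr 1
    · exact Finset.sum_congr rfl fun q _ => congrArg _ (ih q)
    · split_ifs <;> simp

theorem coeff_lift_genericBordered {k : ℕ} (a : Fin d → Matrix (Fin k) (Fin k) K)
    (v : Fin k → K) (i : Fin d) (c : Fin d →₀ ℕ) (f : FreeAlgebra K (Fin d)) (p : Fin k) :
    coeff c (FreeAlgebra.lift K (genericBordered a v i) f p.castSucc (Fin.last k)) =
      (FreeAlgebra.lift K a (cofactor K i c f)).mulVec v p := by
  let φ : FreeAlgebra K (Fin d) →ₗ[K] K :=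
    { toFun := fun f =>
        coeff c (FreeAlgebra.lift K (genericBordered a v i) f p.castSucc (Fin.last k))
      map_add' := by simp
      map_smul' := by simp }
  let ψ : FreeAlgebra K (Fin d) →ₗ[K] K :=
    { toFun := fun f => (FreeAlgebra.lift K a (cofactor K i c f)).mulVec v p
      map_add' := by simp [Matrix.add_mulVec]
      map_smul' := by simp [Matrix.smul_mulVec] }
  have h : φ = ψ := linearMap_ext_word fun l =>
    (coeff_lift_genericBordered_word a v i c l p).trans (by rw [← cofactor_word]; rfl)
  exact LinearMap.congr_fun h f

theorem cofactor_mem_identitiesInVars [CharZero K] {k : ℕ} {f : FreeAlgebra K (Fin d)}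
    (hf : f ∈ identitiesInVars K (upperTriangularAlgebra K (k + 1)) d) (i : Fin d)
    (c : Fin d →₀ ℕ) :
    cofactor K i c f ∈ identitiesInVars K (upperTriangularAlgebra K k) d := by
  rw [mem_identitiesInVars_upperTriangular_iff] at hf ⊢
  intro a ha
  have hz : ∀ (v : Fin k → K) (p : Fin k),
      FreeAlgebra.lift K (genericBordered a v i) f p.castSucc (Fin.last k) = 0 := by
    intro v p
    -- In characteristic zero the field is infinite, so it suffices to specialize the indeterminates
    -- to scalars, where the matrices are upper triangular over `K`.
    refine MvPolynomial.funext fun t => ?_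
    let b : Fin d → Matrix (Fin (k + 1)) (Fin (k + 1)) K := fun j =>
      (genericBordered a v i j).map (MvPolynomial.aeval t)
    have hb : ((MvPolynomial.aeval t : MvPolynomial (Fin d) K →ₐ[K] K).mapMatrix).comp
        (FreeAlgebra.lift K (genericBordered a v i)) = FreeAlgebra.lift K b := by
      refine FreeAlgebra.hom_ext (funext fun j => ?_)
      simp [b]
    have hbt : ∀ j, (b j).BlockTriangular id := fun j x y hxy => by
      have hg : (genericBordered a v i j).BlockTriangular id :=
        bordered_blockTriangular (fun x y hxy => by simp [ha j hxy]) _ _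
      simp [b, hg hxy]
    have h := congrFun (congrFun (hf b hbt) p.castSucc) (Fin.last k)
    rw [← hb] at h
    simpa [MvPolynomial.aeval_eq_eval] using h
  ext p q
  -- A unit vector as border extracts column `q` of the value of the cofactor.
  have h := coeff_lift_genericBordered a (Pi.single q 1) i c f p
  rw [hz, coeff_zero, Matrix.mulVec_single_one] at h
  exact h.symm

end Generic

end Matrices

end UpperTriangularIdentities

namespace UpperTriangularIdentities

/-! ### Dimensions: the recursion for the Hilbert series. -/

section Dimension

theorem finrank_map_eq_of_ker_le {K M N N' : Type*} [Field K] [AddCommGroup M] [Module K M]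
    [AddCommGroup N] [Module K N] [AddCommGroup N'] [Module K N'] (f : M →ₗ[K] N) (p : Submodule K M)
    [Module.Finite K p] (g : p →ₗ[K] N') (hg : Function.Surjective g)
    (h : ∀ x : p, g x = 0 ↔ f x = 0) :
    Module.finrank K (p.map f) = Module.finrank K N' := by
  have h1 := LinearMap.finrank_range_add_finrank_ker (f.domRestrict p)
  have h2 := LinearMap.finrank_range_add_finrank_ker g
  have hk : LinearMap.ker g = LinearMap.ker (f.domRestrict p) := by
    ext x
    simpa using h x
  rw [LinearMap.range_domRestrict] at h1
  rw [LinearMap.range_eq_top.2 hg, finrank_top, hk] at h2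
  omega

variable {d : ℕ} {K : Type*} [Field K]

/-- The pairs consisting of a decomposition `n = c + m` and a non-minimal variable of `c`. -/
abbrev CofactorIndex (n : Fin d →₀ ℕ) : Type :=
  Σ x : Finset.HasAntidiagonal.antidiagonal n, nonMinVars x.1.1

variable (K) in
/-- An element of the component of degree `n` is sent to the sum of its coefficients and to the
classes of its cofactors. -/
noncomputable def cofactors (k : ℕ) (n : Fin d →₀ ℕ) :
    freeComponent K d n →ₗ[K] K × ((x : CofactorIndex n) →
      relativelyFreeComponent K (upperTriangularAlgebra K k) d x.1.1.2) :=
  ((coeffSum d K).toLinearMap.domRestrict _).prod <| LinearMap.pi fun x =>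
    ((Ideal.Quotient.mkₐ K (identitiesInVars K (upperTriangularAlgebra K k) d)).toLinearMap.comp
      (cofactor K x.2.1 x.1.1.1)).restrict fun _ hf => Submodule.mem_map_of_mem <|
        cofactor_mem_freeComponent _ (Finset.HasAntidiagonal.mem_antidiagonal.1 x.1.2) hf

theorem cofactors_eq_zero_iff [CharZero K] {k : ℕ} {n : Fin d →₀ ℕ} (f : freeComponent K d n) :
    cofactors K k n f = 0 ↔
      (Ideal.Quotient.mkₐ K (identitiesInVars K (upperTriangularAlgebra K (k + 1)) d)).toLinearMap
        (f : FreeAlgebra K (Fin d)) = 0 := by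
  have hL : cofactors K k n f = 0 ↔ coeffSum d K (f : FreeAlgebra K (Fin d)) = 0 ∧
      ∀ x : CofactorIndex n, cofactor K x.2.1 x.1.1.1 (f : FreeAlgebra K (Fin d)) ∈
        identitiesInVars K (upperTriangularAlgebra K k) d := by
    rw [Prod.ext_iff, funext_iff]
    refine and_congr Iff.rfl (forall_congr' fun x => ?_)
    rw [Subtype.ext_iff]
    exact Ideal.Quotient.eq_zero_iff_mem
  have hR : (Ideal.Quotient.mkₐ K (identitiesInVars K (upperTriangularAlgebra K (k + 1))
      d)).toLinearMap (f : FreeAlgebra K (Fin d)) = 0 ↔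
      (f : FreeAlgebra K (Fin d)) ∈ identitiesInVars K (upperTriangularAlgebra K (k + 1)) d :=
    Ideal.Quotient.eq_zero_iff_mem
  rw [hL, hR]
  constructor
  · rintro ⟨h1, h2⟩
    rw [eq_coeffSum_smul_add_sum f.2, h1, zero_smul, zero_add]
    exact Ideal.sum_mem _ fun x hx => Ideal.sum_mem _ fun i hi =>
      mul_word_sub_word_mem_identitiesInVars (h2 ⟨⟨x, hx⟩, ⟨i, hi⟩⟩) (cons_sortedWord_perm hi)
  · exact fun h => ⟨coeffSum_eq_zero_of_mem_identitiesInVars h,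
      fun x => cofactor_mem_identitiesInVars h _ _⟩

/-- Coordinates can be prescribed freely: lift each class to a homogeneous element and use the lifts
as coefficients of the straighteners. -/
theorem cofactors_surjective (k : ℕ) (n : Fin d →₀ ℕ) :
    Function.Surjective (cofactors K k n) := by
  rintro ⟨a, y⟩
  choose g hg hgy using fun x => (y x).2
  let f : FreeAlgebra K (Fin d) :=
    a • word K (sortedWord n) + ∑ x : CofactorIndex n, g x * straightener K x.2.1 x.1.1.1
  have hf : f ∈ freeComponent K d n := by
    refine Submodule.add_mem _ (Submodule.smul_mem _ _ ?_) (Submodule.sum_mem _ fun x _ => ?_)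
    · simpa only [content_sortedWord] using word_mem_freeComponent (K := K) (sortedWord n)
    · have h := mul_mem_freeComponent (hg x) (straightener_mem_freeComponent x.2.2)
      rwa [add_comm, Finset.HasAntidiagonal.mem_antidiagonal.1 x.1.2] at h
  have h1 : coeffSum d K f = a := by
    simp [f, coeffSum_straightener]
  have h2 : ∀ x : CofactorIndex n, cofactor K x.2.1 x.1.1.1 f = g x := by
    intro x
    rw [map_add, map_smul, cofactor_word_sortedWord x.2.2, smul_zero, zero_add, map_sum,
      Finset.sum_eq_single x]
    · rw [cofactor_mul_straightener x.2.2 x.2.2, if_pos ⟨rfl, rfl⟩]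
    · intro z _ hz
      rw [cofactor_mul_straightener x.2.2 z.2.2, if_neg]
      rintro ⟨hi, hc⟩
      -- The part `m` is determined by `c`, so an index is determined by `c` and `i`.
      obtain ⟨⟨⟨c, m⟩, hcm⟩, ⟨i, hi'⟩⟩ := x
      obtain ⟨⟨⟨c', m'⟩, hcm'⟩, ⟨i', hi''⟩⟩ := z
      obtain rfl : i' = i := hi
      obtain rfl : c' = c := hc
      have : m' = m := add_left_cancel ((Finset.HasAntidiagonal.mem_antidiagonal.1 hcm').trans
        (Finset.HasAntidiagonal.mem_antidiagonal.1 hcm).symm)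
      subst this
      exact hz rfl
    · exact fun h => absurd (Finset.mem_univ x) h
  refine ⟨⟨f, hf⟩, Prod.ext h1 (funext fun x => Subtype.ext ?_)⟩
  rw [← hgy x, ← h2 x]
  rfl

theorem finrank_relativelyFreeComponent_succ [CharZero K] (k : ℕ) (n : Fin d →₀ ℕ) :
    Module.finrank K (relativelyFreeComponent K (upperTriangularAlgebra K (k + 1)) d n) =
      1 + ∑ x ∈ Finset.HasAntidiagonal.antidiagonal n, (nonMinVars x.1).card *
        Module.finrank K (relativelyFreeComponent K (upperTriangularAlgebra K k) d x.2) := by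
  rw [relativelyFreeComponent, finrank_map_eq_of_ker_le _ _ (cofactors K k n)
    (cofactors_surjective k n) cofactors_eq_zero_iff, Module.finrank_prod, Module.finrank_self,
    Module.finrank_pi_fintype, Fintype.sum_sigma,
    ← Finset.sum_coe_sort (Finset.HasAntidiagonal.antidiagonal n)]
  congr 1
  refine Finset.sum_congr rfl fun x _ => ?_
  refine (Finset.sum_const (Module.finrank K
    (relativelyFreeComponent K (upperTriangularAlgebra K k) d x.1.2))).trans ?_
  rw [Finset.card_univ, Fintype.card_coe, smul_eq_mul]

theorem hilbertSeries_upperTriangular_zero : hilbertSeries K (upperTriangularAlgebra K 0) d = 0 := by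
  ext n
  have h : relativelyFreeComponent K (upperTriangularAlgebra K 0) d n = ⊥ := by
    rw [eq_bot_iff]
    rintro _ ⟨f, -, rfl⟩
    refine Ideal.Quotient.eq_zero_iff_mem.2 (mem_identitiesInVars_iff.2 fun a => ?_)
    ext p
    exact p.elim0
  change (Module.finrank K (relativelyFreeComponent K (upperTriangularAlgebra K 0) d n) : ℚ) = 0
  rw [h, finrank_bot, Nat.cast_zero]

theorem hilbertSeries_upperTriangular_succ [CharZero K] (k : ℕ) :
    hilbertSeries K (upperTriangularAlgebra K (k + 1)) d =
      ∏ i : Fin d, (1 - MvPowerSeries.X i)⁻¹ +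
        (1 + ((∑ i : Fin d, MvPowerSeries.X i) - 1) * ∏ i : Fin d, (1 - MvPowerSeries.X i)⁻¹) *
          hilbertSeries K (upperTriangularAlgebra K k) d := by
  classical
  ext n
  rw [map_add, MvPowerSeries.coeff_mul, coeff_prod_univ_inv_one_sub_X]
  simp only [coeff_one_add_sum_X_sub_one_mul]
  have h : ∀ k n, MvPowerSeries.coeff n (hilbertSeries K (upperTriangularAlgebra K k) d) =
      (Module.finrank K (relativelyFreeComponent K (upperTriangularAlgebra K k) d n) : ℚ) :=
    fun k n => rfl
  simp only [h]
  rw [finrank_relativelyFreeComponent_succ]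
  push_cast
  rfl

end Dimension

end UpperTriangularIdentities

theorem mainTheorem1 (K : Type*) [Field K] [CharZero K] (k d : ℕ) :
    hilbertSeries K (upperTriangularAlgebra K k) d =
        ((∑ i : Fin d, MvPowerSeries.X i) - 1)⁻¹ *
          ((1 + ((∑ i : Fin d, MvPowerSeries.X i) - 1) *
            ∏ i : Fin d, (1 - MvPowerSeries.X i)⁻¹) ^ k - 1) ∧
      hilbertSeries K (upperTriangularAlgebra K k) d =
        ∑ j ∈ Finset.Icc 1 k, (k.choose j : MvPowerSeries (Fin d) ℚ) *
          (∏ i : Fin d, (1 - MvPowerSeries.X i)⁻¹) ^ j *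
            ((∑ i : Fin d, MvPowerSeries.X i) - 1) ^ (j - 1) := by
  have hH := UpperTriangularIdentities.mul_eq_pow_sub_one_of_recursion
    (H := fun k => hilbertSeries K (upperTriangularAlgebra K k) d)
    UpperTriangularIdentities.hilbertSeries_upperTriangular_zero
    UpperTriangularIdentities.hilbertSeries_upperTriangular_succ k
  have hA := MvPowerSeries.inv_mul_cancel _
    (UpperTriangularIdentities.constantCoeff_sum_X_sub_one_ne_zero d)
  constructor
  · rw [← hH, ← mul_assoc, hA, one_mul]
  -- By the binomial theorem the Hilbert series and the finite sum agree after multiplication by the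
  -- invertible A, which is then cancelled.
  · have h := congrArg (((∑ i : Fin d, MvPowerSeries.X i) - 1 : MvPowerSeries (Fin d) ℚ)⁻¹ * ·)
      (hH.trans (UpperTriangularIdentities.mul_sum_Icc_choose _ _ k).symm)
    simpa only [← mul_assoc _⁻¹, hA, one_mul] using h
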